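/- Let $\ell_1$ be the real Banach space of absolutely summable sequences $x=(x_i)_{i\in\mathbb N}$ with the norm $\|x\|_1=\sum_i|x_i|$. Conventions. Let $E$ be a real locally convex space. Call $\mathcal A\subseteq E$ \emph{admissible} if $\mathcal A$ is closed and bounded and its convex closure $\overline{\mathrm{co}}\,\mathcal A$ (the closure of its convex hull) is a complete separable metric space, in the sense that $\overline{\mathrm{co}}\,\mathcal A$ is separable and there are countably many continuous seminorms on $E$ that separate the points of $\overline{\mathrm{co}}\,\mathcal A$, define its topology, and generate a metric in which it is complete. Let $M(\mathcal A)$ be the set of Borel probability measures on $\mathcal A$ with the topology of weak convergence. A point $x\in E$ is the \emph{barycenter} $\mathbf b(\mu)$ of $\mu\in M(\mathcal A)$ if $x=\int_{\mathcal A}y\,\mu(dy)$ as a Pettis integral, i.e. every continuous linear functional $f$ on $E$ is $\mu$-integrable over $\mathcal A$ and $\int_{\mathcal A}f(y)\,\mu(dy)=f(x)$. An admissible set $\mathcal A$ is called \emph{$\mu$-compact} if for every compact set $K\subseteq\overline{\mathrm{co}}\,\mathcal A$ the set $\{\mu\in M(\mathcal A):\mathbf b(\mu)\in K\}$ is a compact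 subset of $M(\mathcal A)$. Proposition. The bounded part $\{x\in\ell_1 : x_i\ge 0 \text{ for all } i,\ \|x\|_1\le 1\}$ of the positive cone of $\ell_1$ is admissible and $\mu$-compact. Moreover (corollary), the set $\mathfrak P_{+\infty}=\{x\in\ell_1 : x_i\ge0 \text{ for all } i,\ \sum_i x_i=1\}$ of all probability distributions with countably many outcomes is also an admissible and $\mu$-compact subset of $\ell_1$. -/

import Mathlib

open MeasureTheory Filter Topology

/-- The convex closure of a set `A`: the closure of its convex hull. -/
def convexClosure {E : Type*} [AddCommGroup E] [Module ℝ E] [TopologicalSpace E]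
    (A : Set E) : Set E :=
  closure (convexHull ℝ A)

/-- The class of sets for which `μ`-compactness is considered: `A` is a closed bounded subset of
the locally convex space `E`, and its convex closure is a complete separable metric space, in the
sense that there are countably many continuous seminorms on `E` which define the topology of the
convex closure and separate its points, such that the convex closure is complete in the metric
generated by these seminorms, and separable. -/
structure IsAdmissible {E : Type*} [AddCommGroup E] [Module ℝ E] [TopologicalSpace E]
    (A : Set E) : Prop where
  isClosed : IsClosed A
  isVonNBounded : Bornology.IsVonNBounded ℝ A
  isSeparable : TopologicalSpace.IsSeparable (convexClosure A)
  exists_seminorms : ∃ p : ℕ → Seminorm ℝ E,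
    (∀ n, Continuous (p n)) ∧
    (∀ x ∈ convexClosure A, ∀ y ∈ convexClosure A, (∀ n, p n (x - y) = 0) → x = y) ∧
    (∀ x ∈ convexClosure A, 𝓝[convexClosure A] x =
      (⨅ n, comap (fun y => p n (y - x)) (𝓝 0)) ⊓ 𝓟 (convexClosure A)) ∧
    (∀ u : ℕ → E, (∀ k, u k ∈ convexClosure A) →
      (∀ n, Tendsto (fun k : ℕ × ℕ => p n (u k.1 - u k.2)) atTop (𝓝 0)) →
      ∃ x ∈ convexClosure A, ∀ n, Tendsto (fun k => p n (u k - x)) atTop (𝓝 0))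

/-- `x` is the barycenter of the measure `m` on the set `A`, i.e. `x` is the Pettis integral
`∫_A y m(dy)`: for every continuous linear functional `f`, the function `f` is `m`-integrable
on `A` and its integral is `f x`. -/
def IsBarycenter {E : Type*} [AddCommGroup E] [Module ℝ E] [TopologicalSpace E]
    {A : Set E} [MeasurableSpace A] (m : Measure A) (x : E) : Prop :=
  ∀ f : E →L[ℝ] ℝ, Integrable (fun y : A => f (y : E)) m ∧ ∫ y : A, f (y : E) ∂m = f x

/-- `A` is `μ`-compact if, for every compact subset `K` of the convex closure of `A`, the set of
all Borel probability measures on `A` whose barycenter lies in `K` is compact in the topology of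
weak convergence. -/
def IsMuCompact {E : Type*} [AddCommGroup E] [Module ℝ E] [TopologicalSpace E]
    (A : Set E) : Prop :=
  letI : MeasurableSpace A := borel A
  haveI : BorelSpace A := ⟨rfl⟩
  ∀ K : Set E, K ⊆ convexClosure A → IsCompact K →
    IsCompact {m : ProbabilityMeasure A | ∃ x ∈ K, IsBarycenter (m : Measure A) x}

/-- The real Banach space `ℓ¹` of absolutely summable sequences. -/
abbrev SeqL1 : Type := lp (fun _ : ℕ => ℝ) 1

/-- The bounded part of the positive cone of `ℓ¹`: its intersection with the closed unit ball. -/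
def boundedPositiveCone : Set SeqL1 :=
  {x | (∀ i, 0 ≤ x i) ∧ ‖x‖ ≤ 1}

/-- The set of all probability distributions with countably many outcomes, as a subset of `ℓ¹`. -/
def probabilityDistributions : Set SeqL1 :=
  {x | (∀ i, 0 ≤ x i) ∧ HasSum (fun i => x i) 1}

/-! On nonnegative sequences the `ℓ¹` norm is the sum of the entries, so the truncation error at `N`
is the value of a continuous linear functional, `tail N`. Its integral against a measure is
therefore its value at the barycenter. By Dini's theorem the tails are uniformly small on a compact
set `K` of barycenters, and Markov's inequality then makes the measures with barycenter in `K`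
concentrate on points with small tails. Bounded sets of nonnegative sequences with uniformly small
tails are totally bounded, so this family of measures is tight. Prokhorov's theorem gives relative
compactness, and the family is closed. -/

section BoundedSubsets

/-- A closed bounded convex separable subset of a real Banach space is admissible. -/
theorem isAdmissible_of_isClosed_of_convex {E : Type*} [NormedAddCommGroup E] [NormedSpace ℝ E]
    [CompleteSpace E] {A : Set E} (hA : IsClosed A) (hconv : Convex ℝ A)
    (hbdd : Bornology.IsBounded A) (hsep : TopologicalSpace.IsSeparable A) : IsAdmissible A := by
  have hcc : convexClosure A = A := by
    rw [convexClosure, hconv.convexHull_eq, hA.closure_eq]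
  refine ⟨hA, NormedSpace.isVonNBounded_of_isBounded ℝ hbdd, hcc.symm ▸ hsep, ?_⟩
  rw [hcc]
  refine ⟨fun _ => normSeminorm ℝ E, fun _ => continuous_norm, ?_, ?_, ?_⟩
  · intro x _ y _ h
    exact sub_eq_zero.1 (norm_eq_zero.1 (h 0))
  · intro x _
    have h : comap (fun y => normSeminorm ℝ E (y - x)) (𝓝 0) = 𝓝 x := by
      simpa [dist_eq_norm] using nhds_comap_dist x
    rw [iInf_const, h, nhdsWithin]
  · intro u hu h
    have hc : CauchySeq u := by
      rw [cauchySeq_iff_tendsto_dist_atTop_0]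
      simpa [dist_eq_norm] using h 0
    obtain ⟨x, hx⟩ := cauchySeq_tendsto_of_complete hc
    exact ⟨x, hA.mem_of_tendsto hx (Eventually.of_forall hu), fun _ =>
      tendsto_iff_norm_sub_tendsto_zero.1 hx⟩

variable {E : Type*} [NormedAddCommGroup E] [NormedSpace ℝ E] {A : Set E}

/-- The restriction of a continuous linear functional to a bounded set, as a bounded continuous
function. -/
noncomputable def restrictBounded (hA : Bornology.IsBounded A) (f : E →L[ℝ] ℝ) :
    BoundedContinuousFunction A ℝ :=
  BoundedContinuousFunction.ofNormedAddCommGroup (fun y : A => f y)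
    (f.continuous.comp continuous_subtype_val) (‖f‖ * hA.exists_norm_le.choose)
    (fun y => (f.le_opNorm y).trans
      (mul_le_mul_of_nonneg_left (hA.exists_norm_le.choose_spec y y.2) (norm_nonneg f)))

@[simp]
theorem restrictBounded_apply (hA : Bornology.IsBounded A) (f : E →L[ℝ] ℝ) (y : A) :
    restrictBounded hA f y = f y := rfl

variable [MeasurableSpace A] [BorelSpace A]

theorem isBarycenter_iff_of_isBounded (hA : Bornology.IsBounded A) (m : Measure A)
    [IsFiniteMeasure m] (x : E) :
    IsBarycenter m x ↔ ∀ f : E →L[ℝ] ℝ, ∫ y : A, f (y : E) ∂m = f x :=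
  ⟨fun h f => (h f).2, fun h f => ⟨(restrictBounded hA f).integrable m, h f⟩⟩

/-- The set of probability measures on a bounded set whose barycenter lies in a given compact set
is closed in the topology of weak convergence. -/
theorem isClosed_setOf_isBarycenter (hA : Bornology.IsBounded A) {K : Set E} (hK : IsCompact K) :
    IsClosed {m : ProbabilityMeasure A | ∃ x ∈ K, IsBarycenter (m : Measure A) x} := by
  have : CompactSpace K := isCompact_iff_compactSpace.1 hK
  -- Pairs (measure, barycenter) form a closed set, and projection along the compact factor `K` is a
  -- closed map; no norm continuity of the barycenter map is needed.
  have hcl : IsClosed {q : ProbabilityMeasure A × K |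
      ∀ f : E →L[ℝ] ℝ, ∫ y : A, f (y : E) ∂(q.1 : Measure A) = f (q.2 : E)} := by
    simp only [Set.ofPred_forall]
    refine isClosed_iInter fun f => isClosed_eq ?_ ?_
    · exact (ProbabilityMeasure.continuous_integral_boundedContinuousFunction
        (restrictBounded hA f)).comp continuous_fst
    · exact f.continuous.comp (continuous_subtype_val.comp continuous_snd)
  convert isClosedMap_fst_of_compactSpace _ hcl using 1
  ext m
  simp [isBarycenter_iff_of_isBounded hA]

end BoundedSubsets

namespace SeqL1

instance separableSpace : TopologicalSpace.SeparableSpace SeqL1 := by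
  have h : TopologicalSpace.IsSeparable
      (closure (Submodule.span ℝ (Set.range fun i : ℕ => lp.single 1 i (1 : ℝ)) : Set SeqL1)) :=
    ((Set.countable_range _).isSeparable.span (R := ℝ)).closure
  rw [← TopologicalSpace.isSeparable_univ_iff]
  refine h.mono fun x _ => ?_
  refine mem_closure_of_tendsto (lp.hasSum_single ENNReal.one_ne_top x)
    (Eventually.of_forall fun s => Submodule.sum_mem _ fun i _ => ?_)
  have : lp.single 1 i (x i) = (x i) • (lp.single 1 i (1 : ℝ) : SeqL1) := by
    rw [← lp.single_smul, smul_eq_mul, mul_one]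
  rw [this]
  exact Submodule.smul_mem _ _ (Submodule.subset_span ⟨i, rfl⟩)

/-- The evaluation of a sequence at an index, as a continuous linear functional. -/
noncomputable def coord (i : ℕ) : SeqL1 →L[ℝ] ℝ :=
  lp.evalCLM ℝ (fun _ : ℕ => ℝ) 1 i

@[simp]
theorem coord_apply (i : ℕ) (x : SeqL1) : coord i x = x i := rfl

/-- The sum of a sequence, as a continuous linear functional. -/
noncomputable def total : SeqL1 →L[ℝ] ℝ := lp.tsumCLM ℝ ℕ ℝ

theorem summable (x : SeqL1) : Summable fun i => x i := by
  have := (lp.hasSum_norm (p := 1) (by simp) x).summable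
  simp only [ENNReal.toReal_one, Real.rpow_one] at this
  exact this.of_norm

theorem hasSum_total (x : SeqL1) : HasSum (fun i => x i) (total x) :=
  (summable x).hasSum

theorem norm_eq_total {x : SeqL1} (hx : ∀ i, 0 ≤ x i) : ‖x‖ = total x := by
  have := lp.hasSum_norm (p := 1) (by simp) x
  simp only [ENNReal.toReal_one, Real.rpow_one, Real.norm_of_nonneg (hx _)] at this
  exact this.unique (hasSum_total x)

/-- The finite sequence with the given first entries, followed by zeros. -/
noncomputable def extendZero (N : ℕ) : (Fin N → ℝ) →L[ℝ] SeqL1 :=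
  LinearMap.toContinuousLinearMap
    (∑ i : Fin N, (lp.lsingle (𝕜 := ℝ) (E := fun _ : ℕ => ℝ) 1 (i : ℕ)).comp (LinearMap.proj i))

/-- The sum of the entries from index `N` on, as a continuous linear functional. -/
noncomputable def tail (N : ℕ) : SeqL1 →L[ℝ] ℝ :=
  total - ∑ i ∈ Finset.range N, coord i

theorem tail_apply (N : ℕ) (x : SeqL1) :
    tail N x = total x - ∑ i ∈ Finset.range N, x i := by
  simp [tail]

theorem tendsto_tail (x : SeqL1) : Tendsto (fun N => tail N x) atTop (𝓝 0) := by
  simpa [tail_apply] using (hasSum_total x).tendsto_sum_nat.const_sub (total x)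

theorem tail_antitone {x : SeqL1} (hx : ∀ i, 0 ≤ x i) : Antitone fun N => tail N x := by
  refine antitone_nat_of_succ_le fun N => ?_
  simp only [tail_apply, Finset.sum_range_succ]
  linarith [hx N]

theorem tail_nonneg {x : SeqL1} (hx : ∀ i, 0 ≤ x i) (N : ℕ) : 0 ≤ tail N x := by
  rw [tail_apply, sub_nonneg]
  exact sum_le_hasSum _ (fun i _ => hx i) (hasSum_total x)

theorem extendZero_apply (N : ℕ) (v : Fin N → ℝ) :
    extendZero N v = ∑ i : Fin N, lp.single 1 (i : ℕ) (v i) := by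
  simp [extendZero]

theorem extendZero_coord (N : ℕ) (x : SeqL1) (j : ℕ) :
    extendZero N (fun i => x i) j = if j < N then x j else 0 := by
  rw [extendZero_apply, Fin.sum_univ_eq_sum_range (fun i => lp.single 1 i (x i)) N]
  rw [← coord_apply, map_sum]
  simp [lp.single_apply, Pi.single_apply]

/-- Positivity is essential here: it turns the norm of the remainder into a linear expression, which
passes through barycenters. -/
theorem norm_sub_extendZero {x : SeqL1} (hx : ∀ i, 0 ≤ x i) (N : ℕ) :
    ‖x - extendZero N (fun i => x i)‖ = tail N x := by
  have h : ∀ j, extendZero N (fun i => x i) j = if j < N then x j else 0 := extendZero_coord N x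
  rw [norm_eq_total, map_sub, tail_apply]
  · congr 1
    refine (hasSum_total _).unique ?_
    simp only [h]
    rw [Finset.sum_congr rfl fun i hi => (if_pos (Finset.mem_range.1 hi)).symm]
    exact hasSum_sum_of_ne_finset_zero fun i hi => if_neg (by simpa using hi)
  · intro j
    rw [lp.coeFn_sub, Pi.sub_apply, h]
    split_ifs
    · simp
    · simpa using hx j

/-- A bounded set of nonnegative summable sequences with uniformly small tails is totally
bounded. -/
theorem totallyBounded_of_tail_le {C : Set SeqL1} (hC : Bornology.IsBounded C)
    (hpos : ∀ x ∈ C, ∀ i, 0 ≤ x i) (htail : ∀ ε > 0, ∃ N, ∀ x ∈ C, tail N x < ε) :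
    TotallyBounded C := by
  rw [Metric.totallyBounded_iff]
  intro ε hε
  obtain ⟨N, hN⟩ := htail (ε / 2) (half_pos hε)
  let r : SeqL1 →L[ℝ] (Fin N → ℝ) := ContinuousLinearMap.pi fun i => coord i
  have hr : Bornology.IsBounded (r '' C) := hC.image r
  -- The truncations lie in a finite-dimensional space, where bounded sets are totally bounded.
  have ht : TotallyBounded (extendZero N '' (r '' C)) :=
    (hr.isCompact_closure.totallyBounded.subset subset_closure).image (extendZero N).uniformContinuous
  obtain ⟨t, ht, hsub⟩ := Metric.totallyBounded_iff.1 ht (ε / 2) (half_pos hε)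
  refine ⟨t, ht, fun x hx => ?_⟩
  obtain ⟨y, hy, hxy⟩ := Set.mem_iUnion₂.1 (hsub ⟨r x, ⟨x, hx, rfl⟩, rfl⟩)
  refine Set.mem_iUnion₂.2 ⟨y, hy, ?_⟩
  have h1 : dist x (extendZero N (r x)) < ε / 2 := by
    rw [dist_eq_norm]
    exact (norm_sub_extendZero (hpos x hx) N).trans_lt (hN x hx)
  rw [Metric.mem_ball] at hxy ⊢
  linarith [dist_triangle x (extendZero N (r x)) y]

/-- Tails are uniformly small on a compact set of nonnegative summable sequences. -/
theorem exists_tail_le_of_isCompact {K : Set SeqL1} (hK : IsCompact K)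
    (hpos : ∀ x ∈ K, ∀ i, 0 ≤ x i) {ε : ℝ} (hε : 0 < ε) : ∃ N, ∀ x ∈ K, tail N x ≤ ε := by
  -- Dini's theorem: continuous functions decreasing pointwise to zero on a compact set.
  have h : TendstoUniformlyOn (fun N x => tail N x) (fun _ => (0 : ℝ)) atTop K :=
    Antitone.tendstoUniformlyOn_of_forall_tendsto hK (fun N => (tail N).continuous.continuousOn)
      (fun x hx => tail_antitone (hpos x hx)) continuousOn_const (fun x _ => tendsto_tail x)
  obtain ⟨N, hN⟩ := (Metric.tendstoUniformlyOn_iff.1 h ε hε).exists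
  refine ⟨N, fun x hx => ?_⟩
  have := hN x hx
  rw [dist_zero_left] at this
  exact (le_abs_self _).trans this.le

variable {A : Set SeqL1} [MeasurableSpace A]

/-- Markov's inequality for the tail functionals: a measure gives small mass to the points with a
large tail if the tail of its barycenter is small. -/
theorem measure_lt_tail_le (hpos : ∀ x ∈ A, ∀ i, 0 ≤ x i) {m : Measure A} [IsFiniteMeasure m]
    {x : SeqL1} (hm : IsBarycenter m x) {N : ℕ} {δ η : ℝ} (hδ : 0 < δ) (hx : tail N x ≤ δ * η) :
    m {y : A | δ < tail N (y : SeqL1)} ≤ ENNReal.ofReal η := by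
  obtain ⟨hint, heq⟩ := hm (tail N)
  have h := mul_meas_ge_le_integral_of_nonneg
    (Eventually.of_forall fun y : A => tail_nonneg (hpos y y.2) N) hint δ
  rw [heq] at h
  have hle : m.real {y : A | δ ≤ tail N (y : SeqL1)} ≤ η :=
    le_of_mul_le_mul_left (h.trans hx) hδ
  calc m {y : A | δ < tail N (y : SeqL1)}
      ≤ m {y : A | δ ≤ tail N (y : SeqL1)} :=
        measure_mono fun y (hy : δ < tail N (y : SeqL1)) => hy.le
    _ = ENNReal.ofReal (m.real {y : A | δ ≤ tail N (y : SeqL1)}) := by simp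
    _ ≤ ENNReal.ofReal η := ENNReal.ofReal_le_ofReal hle

/-- The probability measures on a closed bounded set of nonnegative summable sequences with
barycenters in a given compact set form a tight family. -/
theorem isTightMeasureSet_of_isBarycenter [BorelSpace A] (hA : IsClosed A) (hbdd : Bornology.IsBounded A)
    (hpos : ∀ x ∈ A, ∀ i, 0 ≤ x i) {K : Set SeqL1} (hK : IsCompact K)
    (hKpos : ∀ x ∈ K, ∀ i, 0 ≤ x i) :
    IsTightMeasureSet {m : Measure A | IsFiniteMeasure m ∧ ∃ x ∈ K, IsBarycenter m x} := by
  rw [isTightMeasureSet_iff_exists_isCompact_measure_compl_le]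
  intro ε hε
  obtain ⟨η, hη, hsum⟩ := ENNReal.exists_pos_sum_of_countable' hε.ne' ℕ
  obtain ⟨δ, -, hδ, hδ0⟩ := exists_seq_strictAnti_tendsto (0 : ℝ)
  -- A real `ρ k` below `η k` allows the tails on `K` to be bounded by `δ k * ρ k`, so that Markov
  -- at level `δ k` loses mass at most `ρ k`.
  choose ρ hρ using fun k => ENNReal.lt_iff_exists_real_btwn.1 (hη k)
  have hρ0 : ∀ k, 0 < ρ k := fun k => ENNReal.ofReal_pos.1 (hρ k).2.1
  choose N hN using fun k =>
    exists_tail_le_of_isCompact hK hKpos (mul_pos (hδ k) (hρ0 k))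
  let C : Set SeqL1 := A ∩ ⋂ k, {y | tail (N k) y ≤ δ k}
  have hCcl : IsClosed C := hA.inter (isClosed_iInter fun k =>
    isClosed_le (tail (N k)).continuous continuous_const)
  have hCtb : TotallyBounded C := by
    refine totallyBounded_of_tail_le (hbdd.subset Set.inter_subset_left)
      (fun x hx => hpos x hx.1) fun e he => ?_
    obtain ⟨k, hk⟩ := (hδ0.eventually_lt_const he).exists
    exact ⟨N k, fun x hx => (Set.mem_iInter.1 hx.2 k).trans_lt hk⟩
  have hCcpt : IsCompact C := hCtb.isCompact_of_isClosed hCcl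
  refine ⟨((↑) : A → SeqL1) ⁻¹' C,
    hA.isClosedEmbedding_subtypeVal.isCompact_preimage hCcpt, ?_⟩
  rintro m ⟨hmfin, x, hx, hm⟩
  have hcompl : (((↑) : A → SeqL1) ⁻¹' C)ᶜ ⊆ ⋃ k, {y : A | δ k < tail (N k) (y : SeqL1)} := by
    intro y hy
    by_contra hcon
    refine hy ⟨y.2, Set.mem_iInter.2 fun k => ?_⟩
    exact le_of_not_gt fun hlt : δ k < tail (N k) (y : SeqL1) =>
      hcon (Set.mem_iUnion.2 ⟨k, hlt⟩)
  calc m (((↑) : A → SeqL1) ⁻¹' C)ᶜ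
      ≤ m (⋃ k, {y : A | δ k < tail (N k) (y : SeqL1)}) := measure_mono hcompl
    _ ≤ ∑' k, m {y : A | δ k < tail (N k) (y : SeqL1)} := measure_iUnion_le _
    _ ≤ ∑' k, η k := ENNReal.tsum_le_tsum fun k =>
        (measure_lt_tail_le hpos hm (hδ k) (hN k x hx)).trans (hρ k).2.2.le
    _ ≤ ε := hsum.le

end SeqL1

/-- A closed bounded convex set of nonnegative summable sequences is `μ`-compact. -/
theorem isMuCompact_of_nonneg {A : Set SeqL1} (hA : IsClosed A) (hconv : Convex ℝ A)
    (hbdd : Bornology.IsBounded A) (hpos : ∀ x ∈ A, ∀ i, 0 ≤ x i) : IsMuCompact A := by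
  let : MeasurableSpace A := borel A
  have : BorelSpace A := ⟨rfl⟩
  intro K hKA hK
  rw [convexClosure, hconv.convexHull_eq, hA.closure_eq] at hKA
  rw [← (isClosed_setOf_isBarycenter hbdd hK).closure_eq]
  -- Prokhorov's theorem; closedness lets the closure stand for the set itself.
  refine isCompact_closure_of_isTightMeasureSet
    ((SeqL1.isTightMeasureSet_of_isBarycenter hA hbdd hpos hK fun x hx => hpos x (hKA hx)).subset ?_)
  rintro _ ⟨m, hm, rfl⟩
  exact ⟨inferInstance, hm⟩

theorem SeqL1.isClosed_nonneg : IsClosed {x : SeqL1 | ∀ i, 0 ≤ x i} := by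
  simp only [Set.ofPred_forall]
  exact isClosed_iInter fun i => isClosed_le continuous_const (SeqL1.coord i).continuous

theorem SeqL1.convex_nonneg : Convex ℝ {x : SeqL1 | ∀ i, 0 ≤ x i} := by
  simp only [Set.ofPred_forall]
  exact convex_iInter fun i => convex_halfSpace_ge (SeqL1.coord i).isLinear 0

theorem boundedPositiveCone_eq :
    boundedPositiveCone = {x : SeqL1 | ∀ i, 0 ≤ x i} ∩ Metric.closedBall 0 1 := by
  ext x
  simp [boundedPositiveCone]

theorem probabilityDistributions_eq :
    probabilityDistributions = {x : SeqL1 | ∀ i, 0 ≤ x i} ∩ {x | SeqL1.total x = 1} := by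
  ext x
  exact and_congr_right fun _ =>
    ⟨fun h => (SeqL1.hasSum_total x).unique h, fun h => h ▸ SeqL1.hasSum_total x⟩

theorem probabilityDistributions_subset : probabilityDistributions ⊆ boundedPositiveCone :=
  fun x hx => ⟨hx.1, ((SeqL1.norm_eq_total hx.1).trans
    ((SeqL1.hasSum_total x).unique hx.2)).le⟩

theorem mainTheorem5 :
    (IsAdmissible boundedPositiveCone ∧ IsMuCompact boundedPositiveCone) ∧
      (IsAdmissible probabilityDistributions ∧ IsMuCompact probabilityDistributions) := by
  have key : ∀ A : Set SeqL1, A ⊆ boundedPositiveCone → IsClosed A → Convex ℝ A →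
      IsAdmissible A ∧ IsMuCompact A := by
    intro A hsub hcl hconv
    have hbdd : Bornology.IsBounded A := by
      refine (Metric.isBounded_closedBall (x := (0 : SeqL1)) (r := 1)).subset (hsub.trans ?_)
      rw [boundedPositiveCone_eq]
      exact Set.inter_subset_right
    exact ⟨isAdmissible_of_isClosed_of_convex hcl hconv hbdd (.of_separableSpace A),
      isMuCompact_of_nonneg hcl hconv hbdd fun x hx => (hsub hx).1⟩
  refine ⟨key _ subset_rfl ?_ ?_, key _ probabilityDistributions_subset ?_ ?_⟩
  · rw [boundedPositiveCone_eq]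
    exact SeqL1.isClosed_nonneg.inter Metric.isClosed_closedBall
  · rw [boundedPositiveCone_eq]
    exact SeqL1.convex_nonneg.inter (convex_closedBall 0 1)
  · rw [probabilityDistributions_eq]
    exact SeqL1.isClosed_nonneg.inter (isClosed_eq SeqL1.total.continuous continuous_const)
  · rw [probabilityDistributions_eq]
    exact SeqL1.convex_nonneg.inter (convex_hyperplane SeqL1.total.isLinear 1)
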